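/- \textbf{Setting.} Let $2\le m\le n$. $\mathscr G(n,m)$ is the Grassmannian of $m$-dimensional linear subspaces of $\mathbb R^n$ with the metric $\sphericalangle(F,G)=\|\Pi_F-\Pi_G\|$ (operator norm; $\Pi_F$ is the orthogonal projection onto $F$), and $\Pi_{x+F}(z)=x+\Pi_F(z-x)$. $B_r(x)$ is the open ball, $\mathscr H^m$ the Hausdorff measure, and $C_x(\beta,F)=\{z:|\Pi_{F^\perp}(z-x)|\le\beta|\Pi_F(z-x)|\}$. Let $\alpha,M>0$. A closed set $\Sigma\subset\mathbb R^n$ belongs to $\mathscr A^m(\alpha,M)$ if there are a map $H:\Sigma\to\mathscr G(n,m)$ and a dense subset $\Sigma^*\subset\Sigma$ such that for every compact $K\subset\Sigma$ there are $R_K\in(0,1]$ and $c_K>0$ with the following property: for every $p\in\Sigma^*\cap K$ there is a dense subset $D_p$ of $(p+H(p))\cap B_{R_K}(p)$ such that for every $x\in D_p$ there is $\eta_x\in\Sigma\cap C_p(\alpha,H(p))$ with $\Pi_{p+H(p)}(\eta_x)=x$ and $$\mathscr H^m\big(\{\mu\in\Sigma:\sphericalangle(H(\mu),H(p))<M\alpha\}\cap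 B_r(\eta_x)\big)\ge c_Kr^m\quad\text{for all } r\in(0,R_K/10^5].$$ With $\mathcal R_{xy}(z)=z-\frac{2}{|x-y|^2}\langle z,x-y\rangle(x-y)$, the energy is $$E^\tau(\Sigma)=\int_\Sigma\int_\Sigma\frac{\sphericalangle\big(\mathcal R_{xy}(H(x)),H(y)\big)^{(1+\tau)m}}{|x-y|^{2m}}\,d\mathscr H^m(x)\,d\mathscr H^m(y),$$ and it is locally finite if $E^\tau(\Sigma\cap B_N(0))<\infty$ for all $N\in\mathbb N$. (For non-measurable integrands the integrals are upper integrals.) For $p\in\Sigma$, $F\in\mathscr G(n,m)$, $r>0$ put $$\beta_\Sigma(p,F,r)=\sup_{y\in\Sigma\cap B_r(p)}\frac{\operatorname{dist}\big(y,(p+F)\cap B_r(p)\big)}{r},\qquad \theta_\Sigma(p,F,r)=\frac{\operatorname{dist}_{\mathscr H}\big(\Sigma\cap B_r(p),(p+F)\cap B_r(p)\big)}{r},$$ where $\operatorname{dist}_{\mathscr H}$ is the Hausdorff distance. $\Sigma$ is $(m,\delta)$-Reifenberg-flat if for every compact $K\subset\Sigma$ there is $r_0>0$ such that for all $p\in K$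 and $r\in(0,r_0]$ there is $F\in\mathscr G(n,m)$ with $\theta_\Sigma(p,F,r)\le\delta$. \textbf{Theorem.} Let $\delta\in(0,1)$, $\alpha,M>0$ with $\alpha(M+1)<\delta/50$, and $\tau>-1$. Let $\Sigma\in\mathscr A^m(\alpha,M)$, with $H$ and $\Sigma^*$ as above, have locally finite energy $E^\tau$. For $p\in\Sigma$ call $G\in\mathscr G(n,m)$ an \emph{approximating plane at $p$} if either $p\in\Sigma^*$ and $G=H(p)$, or $p\notin\Sigma^*$ and $G$ is an accumulation point of $(H(p_k))_k$ for some sequence $p_k\in\Sigma^*$ with $p_k\to p$. Then for every compact $K\subset\Sigma$ (with $R_K$ any radius as in the definition above) there are $r_K,\rho_K\in(0,R_K]$ such that for every $p\in K$ an approximating plane at $p$ exists, and every approximating plane $G_p$ at $p$ satisfies: \begin{enumerate} \item for all $r\in(0,r_K]$, the set $\Sigma\cap B_r(p)$ lies in the closed $\delta r$-neighbourhood of $p+G_p$, and $\beta_\Sigma(p,G_p,r)\le\delta$; \item for all $r\in(0,\rho_K]$, $\ \sup_{\xi\in(p+G_p)\cap B_r(p)}\operatorname{dist}\big(\xi,\Sigma\cap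 B_r(p)\big)/r\le 2\alpha/\sqrt{1+\alpha^2}$, with strict inequality if $p\in\Sigma^*$; \item for all $r\in(0,\min\{r_K,\rho_K\}]$, $\ \theta_\Sigma(p,G_p,r)\le\delta$. \end{enumerate} In particular, $\Sigma$ is $(m,\delta)$-Reifenberg-flat. -/

import Mathlib

open MeasureTheory Set Filter Topology
open scoped ENNReal

noncomputable section

namespace MoebiusEnergy

/-- Euclidean space `ℝⁿ`. -/
abbrev E (n : ℕ) : Type := EuclideanSpace ℝ (Fin n)

/-- The Grassmannian `𝒢(n,m)` of `m`-dimensional linear subspaces of `ℝⁿ`. -/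
@[ext]
structure Grassmannian (n m : ℕ) : Type where
  /-- the underlying linear subspace -/
  plane : Submodule ℝ (E n)
  finrank_eq : Module.finrank ℝ plane = m

/-- The angle metric `∢(F,G) = ‖Π_F - Π_G‖` (operator norm of the difference of the orthogonal
projections). -/
def angle {n : ℕ} (F G : Submodule ℝ (E n)) : ℝ :=
  ‖F.starProjection - G.starProjection‖

theorem Grassmannian.starProjection_injective (n m : ℕ) :
    Function.Injective (fun F : Grassmannian n m => F.plane.starProjection) := by
  intro F G h
  ext x
  have h' : F.plane.starProjection = G.plane.starProjection := h
  rw [← Submodule.starProjection_eq_self_iff (K := F.plane),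
    ← Submodule.starProjection_eq_self_iff (K := G.plane), h']

/-- The Grassmannian carries the angle metric. -/
instance (n m : ℕ) : MetricSpace (Grassmannian n m) :=
  MetricSpace.induced (fun F : Grassmannian n m => F.plane.starProjection)
    (Grassmannian.starProjection_injective n m) inferInstance

theorem Grassmannian.dist_eq_angle {n m : ℕ} (F G : Grassmannian n m) :
    dist F G = angle F.plane G.plane :=
  dist_eq_norm F.plane.starProjection G.plane.starProjection

/-- The affine plane `x + F`. -/
def affinePlane {n : ℕ} (x : E n) (F : Submodule ℝ (E n)) : Set (E n) :=
  {z | z - x ∈ F}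

/-- The orthogonal projection `Π_{x+F}(z) = x + Π_F(z - x)` onto the affine plane `x + F`. -/
def affineProj {n : ℕ} (x : E n) (F : Submodule ℝ (E n)) (z : E n) : E n :=
  x + F.starProjection (z - x)

/-- The cone `C_x(β,F) = {z : |Π_{F^⊥}(z - x)| ≤ β |Π_F(z - x)|}`. -/
def cone {n : ℕ} (x : E n) (β : ℝ) (F : Submodule ℝ (E n)) : Set (E n) :=
  {z | ‖Fᗮ.starProjection (z - x)‖ ≤ β * ‖F.starProjection (z - x)‖}

/-! ### Admissible sets

The map `H : S → 𝒢(n,m)` of mock tangent planes is represented by a map on all of `ℝⁿ`; only its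
values on `S` are ever used. -/

/-- `E_{α,M}(p) = {μ ∈ S : ∢(H(μ),H(p)) < M α}`. -/
def nearlyParallel {n m : ℕ} (α M : ℝ) (S : Set (E n)) (H : E n → Grassmannian n m) (p : E n) :
    Set (E n) :=
  {μ | μ ∈ S ∧ angle (H μ).plane (H p).plane < M * α}

/-- `R` can serve as the radius `R_K` belonging to the set `K` in the definition of admissible sets
(together with some constant `c_K > 0`). -/
def IsAdmissibleRadius {n m : ℕ} (α M : ℝ) (S : Set (E n)) (H : E n → Grassmannian n m)
    (Sstar K : Set (E n)) (R : ℝ) : Prop :=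
  R ∈ Ioc (0 : ℝ) 1 ∧ ∃ c : ℝ, 0 < c ∧ ∀ p ∈ Sstar ∩ K,
    ∃ D : Set (E n), D ⊆ affinePlane p (H p).plane ∩ Metric.ball p R ∧
      affinePlane p (H p).plane ∩ Metric.ball p R ⊆ closure D ∧
      ∀ x ∈ D, ∃ η ∈ S ∩ cone p α (H p).plane,
        affineProj p (H p).plane η = x ∧
        ∀ r ∈ Ioc (0 : ℝ) (R / 10 ^ 5),
          ENNReal.ofReal (c * r ^ m) ≤
            Measure.hausdorffMeasure (m : ℝ) (nearlyParallel α M S H p ∩ Metric.ball η r)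

/-- `S` is an admissible set, `S ∈ 𝒜^m(α,M)`, as witnessed by the mock tangent planes `H` and the
dense subset `Sstar`. -/
structure IsAdmissible {n m : ℕ} (α M : ℝ) (S : Set (E n)) (H : E n → Grassmannian n m)
    (Sstar : Set (E n)) : Prop where
  isClosed : IsClosed S
  subset : Sstar ⊆ S
  dense : S ⊆ closure Sstar
  radius : ∀ K ⊆ S, IsCompact K → ∃ R : ℝ, IsAdmissibleRadius α M S H Sstar K R

/-! ### The energy -/

/-- The upper integral. It is the usual integral when the integrand is (a.e.) measurable, see
`upperLIntegral_eq_lintegral`; it gives the energy a meaning for every map `H`, with no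
measurability assumption. -/
def upperLIntegral {X : Type*} [MeasurableSpace X] (μ : Measure X) (f : X → ℝ≥0∞) : ℝ≥0∞ :=
  ⨅ (g : X → ℝ≥0∞) (_ : Measurable g) (_ : f ≤ g), ∫⁻ x, g x ∂μ

theorem upperLIntegral_eq_lintegral {X : Type*} [MeasurableSpace X] (μ : Measure X)
    {f : X → ℝ≥0∞} (hf : AEMeasurable f μ) : upperLIntegral μ f = ∫⁻ x, f x ∂μ := by
  classical
  refine le_antisymm ?_ (le_iInf fun g => le_iInf fun _ => le_iInf fun h => lintegral_mono h)
  set N : Set X := toMeasurable μ {x | f x ≠ hf.mk f x} with hN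
  have hN0 : μ N = 0 := by rw [hN, measure_toMeasurable]; exact hf.ae_eq_mk
  have hNm : MeasurableSet N := measurableSet_toMeasurable _ _
  have hg : Measurable (N.piecewise (fun _ => (∞ : ℝ≥0∞)) (hf.mk f)) :=
    measurable_const.piecewise hNm hf.measurable_mk
  have hfg : f ≤ N.piecewise (fun _ => (∞ : ℝ≥0∞)) (hf.mk f) := by
    intro x
    by_cases hx : x ∈ N
    · simp [hx]
    · have hx' : f x = hf.mk f x := by
        by_contra hne
        exact hx (subset_toMeasurable μ _ hne)
      simp [hx, hx']
  have hle : upperLIntegral μ f ≤ ∫⁻ x, N.piecewise (fun _ => (∞ : ℝ≥0∞)) (hf.mk f) x ∂μ := by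
    unfold upperLIntegral
    exact (iInf_le _ _).trans ((iInf_le _ hg).trans (iInf_le _ hfg))
  refine hle.trans_eq (lintegral_congr_ae ?_)
  have hae : ∀ᵐ x ∂μ, x ∉ N := measure_eq_zero_iff_ae_notMem.1 hN0
  filter_upwards [hae, hf.ae_eq_mk] with x hx hx'
  simp [hx, hx']

/-- The reflection `ℛ_{xy}` at the subspace `(x - y)^⊥`. -/
def reflect {n : ℕ} (x y : E n) : E n ≃ₗᵢ[ℝ] E n :=
  (Submodule.span ℝ {x - y})ᗮ.reflection

theorem reflect_apply {n : ℕ} (x y z : E n) :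
    reflect x y z = z - (2 / ‖x - y‖ ^ 2 * inner ℝ z (x - y)) • (x - y) := by
  rw [reflect, Submodule.reflection_orthogonal_apply, Submodule.reflection_singleton_apply,
    real_inner_comm]
  simp only [RCLike.ofReal_real_eq_id, id_eq, neg_sub, two_smul, ← add_smul]
  congr 2
  ring

/-- The energy `E^τ(S) = ∫_S ∫_S ∢(ℛ_{xy}(H(x)),H(y))^{(1+τ)m} / |x-y|^{2m} dℋ^m(x) dℋ^m(y)`. -/
def energy {n m : ℕ} (τ : ℝ) (S : Set (E n)) (H : E n → Grassmannian n m) : ℝ≥0∞ :=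
  upperLIntegral ((Measure.hausdorffMeasure (m : ℝ)).restrict S) fun y =>
    upperLIntegral ((Measure.hausdorffMeasure (m : ℝ)).restrict S) fun x =>
      ENNReal.ofReal
        (angle ((H x).plane.map (reflect x y).toLinearMap) (H y).plane ^ ((1 + τ) * (m : ℝ)) /
          ‖x - y‖ ^ (2 * m))

/-- Locally finite energy: `E^τ(S ∩ B_N(0)) < ∞` for all `N ∈ ℕ`. -/
def HasLocallyFiniteEnergy {n m : ℕ} (τ : ℝ) (S : Set (E n)) (H : E n → Grassmannian n m) : Prop :=
  ∀ N : ℕ, energy τ (S ∩ Metric.ball 0 (N : ℝ)) H < ∞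

/-! ### Flatness -/

/-- `β_S(p,F,r) = sup_{y ∈ S ∩ B_r(p)} dist(y, (p+F) ∩ B_r(p)) / r`. -/
def betaNumber {n : ℕ} (S : Set (E n)) (p : E n) (F : Submodule ℝ (E n)) (r : ℝ) : ℝ :=
  ⨆ y : ↥(S ∩ Metric.ball p r),
    Metric.infDist (y : E n) (affinePlane p F ∩ Metric.ball p r) / r

/-- `sup_{ξ ∈ (p+F) ∩ B_r(p)} dist(ξ, S ∩ B_r(p)) / r`. -/
def planeToSet {n : ℕ} (S : Set (E n)) (p : E n) (F : Submodule ℝ (E n)) (r : ℝ) : ℝ :=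
  ⨆ ξ : ↥(affinePlane p F ∩ Metric.ball p r),
    Metric.infDist (ξ : E n) (S ∩ Metric.ball p r) / r

/-- `θ_S(p,F,r) = dist_ℋ(S ∩ B_r(p), (p+F) ∩ B_r(p)) / r`. -/
def thetaNumber {n : ℕ} (S : Set (E n)) (p : E n) (F : Submodule ℝ (E n)) (r : ℝ) : ℝ :=
  Metric.hausdorffDist (S ∩ Metric.ball p r) (affinePlane p F ∩ Metric.ball p r) / r

/-- `S` is an `(m,δ)`-Reifenberg-flat set. -/
def IsReifenbergFlat {n : ℕ} (m : ℕ) (δ : ℝ) (S : Set (E n)) : Prop :=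
  ∀ K ⊆ S, IsCompact K → ∃ r₀ : ℝ, 0 < r₀ ∧ ∀ p ∈ K, ∀ r ∈ Ioc (0 : ℝ) r₀,
    ∃ F : Grassmannian n m, thetaNumber S p F.plane r ≤ δ

/-- The planes `G` allowed as `G_p`: `G = H(p)` if `p ∈ Sstar`; otherwise any accumulation point of
a sequence `H(p_k)` with `p_k ∈ Sstar` and `p_k → p`. -/
def IsApproximatingPlane {n m : ℕ} (H : E n → Grassmannian n m) (Sstar : Set (E n)) (p : E n)
    (G : Grassmannian n m) : Prop :=
  (p ∈ Sstar ∧ G = H p) ∨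
    (p ∉ Sstar ∧ ∃ q : ℕ → E n, (∀ k, q k ∈ Sstar) ∧ Tendsto q atTop (𝓝 p) ∧
      MapClusterPt G atTop fun k => H (q k))

end MoebiusEnergy

end

open MoebiusEnergy

/-!
The energy is scaling invariant, so finiteness of the energy forbids a fixed amount of it from being
carried by pairs of balls at arbitrarily small scales. This is turned into flatness as follows.

Let `p`, `q` be in the dense subset, `r = |q - p|`, `F = H(p)`, and suppose that the component of
`q - p` orthogonal to `F` is longer than `δ r`. The cone condition provides points of `S` above any
vector `v ∈ F`, and these are displaced from `p + v` only in directions orthogonal to `F`. Hence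
there is a point `x₁` near `p` such that `q - x₁` is nearly orthogonal to `F`, so that the
reflection at `(q - x₁)^⊥` almost preserves `F` (`angle_map_reflect_self_le`), and a point `x₂` such
that `q - x₂` has a component of length about `r` along `F` and one of length at least about `δ r`
orthogonal to it, so that the reflection at `(q - x₂)^⊥` moves `F` by an angle comparable to `δ`
(`le_angle_map_reflect_self`). If both reflections mapped planes close to `F` to nearly `H(q)`,
their effects on `F` would nearly agree, which they do not. So for one of the two points the
numerator of the energy density is at least a constant on the product of a ball around it and a ball
near `q`, both of radius comparable to `r`, when restricted to nearly parallel mock tangent planes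
(`exists_balls_le_angle`).

The two balls are disjoint, and by the symmetry of the integrand each of them has mass at least a
constant for the finite measure whose density is a measurable majorant of the inner (upper)
integral. As `r → 0` this is impossible, because small punctured balls have small mass
(`exists_radius_measure_lt_of_disjoint`). Working with one majorant for both balls means that no
measurability of `H` and no convergence theorem for upper integrals is needed. The result,
`exists_radius_norm_orthogonal_le`, passes to limits and bounds the distance from `S` to the
approximating planes. The distance from the planes to `S` is controlled by the cone condition alone
(`IsAdmissibleAt.infDist_le`), and approximating planes exist since the Grassmannian is compact.
-/

namespace MoebiusEnergy

variable {n m : ℕ}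

/-! ### The angle between planes and reflections -/

theorem angle_nonneg (F G : Submodule ℝ (E n)) : 0 ≤ angle F G := norm_nonneg _

theorem angle_comm (F G : Submodule ℝ (E n)) : angle F G = angle G F := norm_sub_rev _ _

theorem angle_triangle (F G L : Submodule ℝ (E n)) : angle F L ≤ angle F G + angle G L :=
  norm_sub_le_norm_sub_add_norm_sub _ _ _

theorem norm_starProjection_sub_le_angle (F G : Submodule ℝ (E n)) (v : E n) :
    ‖F.starProjection v - G.starProjection v‖ ≤ angle F G * ‖v‖ :=
  (F.starProjection - G.starProjection).le_opNorm v

theorem reflect_symm (x y : E n) : (reflect x y).symm = reflect x y :=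
  Submodule.reflection_symm

theorem reflect_reflect (x y z : E n) : reflect x y (reflect x y z) = z :=
  Submodule.reflection_reflection _ z

theorem reflect_comm (x y : E n) : reflect x y = reflect y x := by
  ext1 z
  rw [reflect_apply, reflect_apply, norm_sub_rev, ← neg_sub y x, inner_neg_right]
  module

theorem starProjection_map_reflect (x y : E n) (F : Submodule ℝ (E n)) (v : E n) :
    (F.map (reflect x y).toLinearMap).starProjection v =
      reflect x y (F.starProjection (reflect x y v)) := by
  have h := Submodule.starProjection_map_apply (reflect x y) F v
  rw [reflect_symm] at h
  exact h

theorem angle_map_reflect_le (x y : E n) (F G : Submodule ℝ (E n)) :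
    angle (F.map (reflect x y).toLinearMap) (G.map (reflect x y).toLinearMap) ≤ angle F G := by
  refine ContinuousLinearMap.opNorm_le_bound _ (angle_nonneg _ _) fun v => ?_
  rw [sub_apply, starProjection_map_reflect, starProjection_map_reflect,
    ← map_sub, LinearIsometryEquiv.norm_map]
  simpa using norm_starProjection_sub_le_angle F G (reflect x y v)

theorem map_reflect_map_reflect (x y : E n) (F : Submodule ℝ (E n)) :
    (F.map (reflect x y).toLinearMap).map (reflect x y).toLinearMap = F := by
  ext z
  constructor
  · rintro ⟨_, ⟨v, hv, rfl⟩, rfl⟩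
    exact (reflect_reflect x y v).symm ▸ hv
  · exact fun hz => ⟨_, ⟨z, hz, rfl⟩, reflect_reflect x y z⟩

theorem angle_map_reflect_comm (x y : E n) (F G : Submodule ℝ (E n)) :
    angle (F.map (reflect x y).toLinearMap) G = angle (G.map (reflect y x).toLinearMap) F := by
  rw [reflect_comm y x]
  apply le_antisymm
  · have := angle_map_reflect_le x y F (G.map (reflect x y).toLinearMap)
    rwa [map_reflect_map_reflect, angle_comm F] at this
  · have := angle_map_reflect_le x y G (F.map (reflect x y).toLinearMap)
    rwa [map_reflect_map_reflect, angle_comm G] at this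

/-- A reflection moves `F` only a little if its axis is almost orthogonal to `F`. -/
theorem angle_map_reflect_self_le (x y : E n) (F : Submodule ℝ (E n)) :
    angle (F.map (reflect x y).toLinearMap) F ≤
      4 * (‖F.starProjection (x - y)‖ / ‖x - y‖) := by
  refine ContinuousLinearMap.opNorm_le_bound _ (by positivity) fun v => ?_
  rw [sub_apply, starProjection_map_reflect]
  set w := x - y with hw
  set P := F.starProjection
  rcases eq_or_ne w 0 with h0 | h0
  · have h1 : ∀ z, reflect x y z = z := fun z => by
      rw [reflect_apply, ← hw, h0]; simp
    simp [h1, h0]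
  have hw0 : 0 < ‖w‖ := norm_pos_iff.2 h0
  have e : reflect x y (P (reflect x y v)) - P v =
      -((2 / ‖w‖ ^ 2 * inner ℝ v w) • P w) - (2 / ‖w‖ ^ 2 * inner ℝ (reflect x y v) (P w)) • w := by
    have h1 : inner ℝ (P (reflect x y v)) w = inner ℝ (reflect x y v) (P w) :=
      Submodule.inner_starProjection_left_eq_right F _ _
    rw [reflect_apply x y (P _), ← hw, h1]
    rw [show P (reflect x y v) = P v - (2 / ‖w‖ ^ 2 * inner ℝ v w) • P w by
      rw [reflect_apply, map_sub, map_smul]]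
    abel
  rw [e]
  have h1 : |inner ℝ v w| ≤ ‖v‖ * ‖w‖ := abs_real_inner_le_norm _ _
  have h2 : |inner ℝ (reflect x y v) (P w)| ≤ ‖v‖ * ‖P w‖ := by
    simpa using abs_real_inner_le_norm (reflect x y v) (P w)
  calc _ ≤ ‖(2 / ‖w‖ ^ 2 * inner ℝ v w) • P w‖
        + ‖(2 / ‖w‖ ^ 2 * inner ℝ (reflect x y v) (P w)) • w‖ := by
        simpa using norm_sub_le (-((2 / ‖w‖ ^ 2 * inner ℝ v w) • P w)) _
    _ = 2 / ‖w‖ ^ 2 * |inner ℝ v w| * ‖P w‖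
        + 2 / ‖w‖ ^ 2 * |inner ℝ (reflect x y v) (P w)| * ‖w‖ := by
        rw [norm_smul, norm_smul, Real.norm_eq_abs, Real.norm_eq_abs, abs_mul, abs_mul,
          abs_of_nonneg (by positivity : 0 ≤ 2 / ‖w‖ ^ 2)]
    _ ≤ 2 / ‖w‖ ^ 2 * (‖v‖ * ‖w‖) * ‖P w‖ + 2 / ‖w‖ ^ 2 * (‖v‖ * ‖P w‖) * ‖w‖ := by gcongr
    _ = 4 * (‖P w‖ / ‖w‖) * ‖v‖ := by field_simp; ring

/-- A reflection moves `F` visibly if its axis has substantial components both along `F` and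
orthogonal to `F`. -/
theorem le_angle_map_reflect_self (x y : E n) (F : Submodule ℝ (E n)) :
    2 * ‖F.starProjection (x - y)‖ * ‖Fᗮ.starProjection (x - y)‖ / ‖x - y‖ ^ 2 ≤
      angle (F.map (reflect x y).toLinearMap) F := by
  rw [Submodule.starProjection_orthogonal_val]
  set w := x - y with hw
  set P := F.starProjection
  rcases eq_or_ne (P w) 0 with h0 | h0
  · simp [h0, angle_nonneg]
  have hf0 : 0 < ‖P w‖ := norm_pos_iff.2 h0
  have hPP : P (P w) = P w := Submodule.starProjection_eq_self_iff.2 (F.starProjection_apply_mem w)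
  have hin : inner ℝ (P w) w = ‖P w‖ ^ 2 := by
    conv_lhs => rw [← hPP]
    rw [Submodule.inner_starProjection_left_eq_right, real_inner_self_eq_norm_sq]
  have h := norm_starProjection_sub_le_angle (F.map (reflect x y).toLinearMap) F
    (reflect x y (P w))
  rw [starProjection_map_reflect, reflect_reflect, LinearIsometryEquiv.norm_map] at h
  change ‖reflect x y (P (P w)) - P (reflect x y (P w))‖ ≤ _ at h
  have e : reflect x y (P (P w)) - P (reflect x y (P w)) =
      -((2 / ‖w‖ ^ 2 * ‖P w‖ ^ 2) • (w - P w)) := by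
    have hP : ∀ c : ℝ, P (P w - c • w) = P w - c • P w := fun c => by
      rw [P.map_sub, P.map_smul, hPP]
    rw [hPP, reflect_apply, ← hw, hin, hP]
    module
  rw [e, norm_neg, norm_smul, Real.norm_of_nonneg (by positivity)] at h
  refine le_of_mul_le_mul_right (le_trans (le_of_eq ?_) h) hf0
  ring

/-! ### Pairs of balls carrying a fixed amount of energy -/

/-- The defining property of an admissible set at a single point `p` of the dense subset, with
radius `R` and density constant `c`. -/
def IsAdmissibleAt (α M : ℝ) (S : Set (E n)) (H : E n → Grassmannian n m) (R c : ℝ) (p : E n) :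
    Prop :=
  ∃ D : Set (E n), D ⊆ affinePlane p (H p).plane ∩ Metric.ball p R ∧
    affinePlane p (H p).plane ∩ Metric.ball p R ⊆ closure D ∧
    ∀ x ∈ D, ∃ η ∈ S ∩ cone p α (H p).plane,
      affineProj p (H p).plane η = x ∧
      ∀ r ∈ Ioc (0 : ℝ) (R / 10 ^ 5),
        ENNReal.ofReal (c * r ^ m) ≤
          Measure.hausdorffMeasure (m : ℝ) (nearlyParallel α M S H p ∩ Metric.ball η r)

theorem norm_starProjection_le (F : Submodule ℝ (E n)) (v : E n) : ‖F.starProjection v‖ ≤ ‖v‖ :=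
  Submodule.norm_starProjection_apply_le F v

theorem starProjection_add_orthogonal (F : Submodule ℝ (E n)) (v : E n) :
    F.starProjection v + Fᗮ.starProjection v = v := by
  rw [Submodule.starProjection_orthogonal_val]; abel

/-- Above every vector `v` of the mock tangent plane there is, up to an arbitrarily small error, a
point of `S` inside the cone around which `S` has nearly parallel mock tangent planes on a set of
large measure. -/
theorem IsAdmissibleAt.exists_point {α M R c : ℝ} {S : Set (E n)} {H : E n → Grassmannian n m}
    {p : E n} (h : IsAdmissibleAt α M S H R c p) (hα : 0 < α) {v : E n} (hv : v ∈ (H p).plane)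
    (hvR : ‖v‖ < R) {s : ℝ} (hs : 0 < s) :
    ∃ η ∈ S, ‖(H p).plane.starProjection (η - p) - v‖ < s ∧
      ‖(H p).planeᗮ.starProjection (η - p)‖ ≤ α * (‖v‖ + s) ∧
      ∀ r ∈ Ioc (0 : ℝ) (R / 10 ^ 5), ENNReal.ofReal (c * r ^ m) ≤
        Measure.hausdorffMeasure (m : ℝ) (nearlyParallel α M S H p ∩ Metric.ball η r) := by
  obtain ⟨D, -, hD, hη⟩ := h
  have hmem : p + v ∈ affinePlane p (H p).plane ∩ Metric.ball p R := by
    simpa [affinePlane] using ⟨hv, hvR⟩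
  obtain ⟨x, hxD, hx⟩ := Metric.mem_closure_iff.1 (hD hmem) s hs
  obtain ⟨η, ⟨hηS, hc⟩, hpr, hmeas⟩ := hη x hxD
  have h1 : ‖(H p).plane.starProjection (η - p) - v‖ < s := by
    have e : (H p).plane.starProjection (η - p) - v = x - (p + v) := by
      rw [← hpr, affineProj]; abel
    rw [e, ← dist_eq_norm, dist_comm]
    exact hx
  refine ⟨η, hηS, h1, ?_, hmeas⟩
  have h2 := norm_le_insert' ((H p).plane.starProjection (η - p)) v
  have h3 : ‖(H p).planeᗮ.starProjection (η - p)‖ ≤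
    α * ‖(H p).plane.starProjection (η - p)‖ := hc
  exact h3.trans (by gcongr; linarith)

/-- Components of the difference of two points, one near `p + v` and one near `q`. -/
theorem norm_components_sub_le {F : Submodule ℝ (E n)} {p q v η ζ x y : E n} {s t u : ℝ}
    (hη : ‖F.starProjection (η - p) - v‖ ≤ s) (hη' : ‖Fᗮ.starProjection (η - p)‖ ≤ t)
    (hζ : ‖ζ - q‖ ≤ u) (hx : ‖x - η‖ ≤ s) (hy : ‖y - ζ‖ ≤ s) :
    ‖F.starProjection (x - y) - (v - F.starProjection (q - p))‖ ≤ 3 * s + u ∧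
      ‖Fᗮ.starProjection (x - y) + Fᗮ.starProjection (q - p)‖ ≤ 2 * s + t + u := by
  have e : x - y = (x - η) + (η - p) - (q - p) - (y - ζ) - (ζ - q) := by abel
  constructor
  · have e1 : F.starProjection (x - y) - (v - F.starProjection (q - p)) =
        F.starProjection (x - η) + (F.starProjection (η - p) - v) - F.starProjection (y - ζ)
          - F.starProjection (ζ - q) := by
      rw [e, map_sub, map_sub, map_sub, map_add]; abel
    rw [e1]
    have h1 := norm_starProjection_le F (x - η)
    have h2 := norm_starProjection_le F (y - ζ)
    have h3 := norm_starProjection_le F (ζ - q)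
    refine (norm_sub_le _ _).trans ?_
    have h4 := norm_sub_le (F.starProjection (x - η) + (F.starProjection (η - p) - v))
      (F.starProjection (y - ζ))
    have h5 := norm_add_le (F.starProjection (x - η)) (F.starProjection (η - p) - v)
    linarith
  · have e1 : Fᗮ.starProjection (x - y) + Fᗮ.starProjection (q - p) =
        Fᗮ.starProjection (x - η) + Fᗮ.starProjection (η - p) - Fᗮ.starProjection (y - ζ)
          - Fᗮ.starProjection (ζ - q) := by
      rw [e, map_sub, map_sub, map_sub, map_add]; abel
    rw [e1]
    have h1 := norm_starProjection_le Fᗮ (x - η)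
    have h2 := norm_starProjection_le Fᗮ (y - ζ)
    have h3 := norm_starProjection_le Fᗮ (ζ - q)
    refine (norm_sub_le _ _).trans ?_
    have h4 := norm_sub_le (Fᗮ.starProjection (x - η) + Fᗮ.starProjection (η - p))
      (Fᗮ.starProjection (y - ζ))
    have h5 := norm_add_le (Fᗮ.starProjection (x - η)) (Fᗮ.starProjection (η - p))
    linarith

/-- Two reflections that both move (planes close to) `F` to (planes close to) `G` act on `F` in
nearly the same way. -/
theorem angle_map_reflect_self_le_add {F G F₁ F₂ G₁ G₂ : Submodule ℝ (E n)} {x₁ x₂ y₁ y₂ : E n}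
    {t κ : ℝ} (hF₁ : angle F₁ F ≤ t) (hF₂ : angle F₂ F ≤ t) (hG₁ : angle G₁ G ≤ t)
    (hG₂ : angle G₂ G ≤ t)
    (h₁ : angle (F₁.map (reflect x₁ y₁).toLinearMap) G₁ ≤ κ)
    (h₂ : angle (F₂.map (reflect x₂ y₂).toLinearMap) G₂ ≤ κ) :
    angle (F.map (reflect x₂ y₂).toLinearMap) F ≤
      4 * t + 2 * κ + angle (F.map (reflect x₁ y₁).toLinearMap) F := by
  have a1 := angle_triangle (F.map (reflect x₂ y₂).toLinearMap)
    (F₂.map (reflect x₂ y₂).toLinearMap) F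
  have a2 := angle_triangle (F₂.map (reflect x₂ y₂).toLinearMap) G₂ F
  have a3 := angle_triangle G₂ G F
  have a4 := angle_triangle G G₁ F
  have a5 := angle_triangle G₁ (F₁.map (reflect x₁ y₁).toLinearMap) F
  have a6 := angle_triangle (F₁.map (reflect x₁ y₁).toLinearMap)
    (F.map (reflect x₁ y₁).toLinearMap) F
  have b1 := angle_map_reflect_le x₂ y₂ F F₂
  have b2 := angle_map_reflect_le x₁ y₁ F₁ F
  rw [angle_comm F F₂] at b1
  rw [angle_comm G G₁] at a4
  rw [angle_comm G₁ (F₁.map _)] at a5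
  linarith

/-- If `q` deviates from the mock tangent plane at `p` by more than `δ |q - p|`, then there are two
balls of radius comparable to `|q - p|` near `p` and `q` on which the integrand of the energy is
large for all pairs of points with nearly parallel mock tangent planes. The factor `δ ^ 2` in the
radius is needed because positional errors of the size of the radius must be small compared to
`δ |x - y|`, where `|x - y|` may itself be as small as about `δ |q - p|`. -/
theorem exists_balls_le_angle {α M δ R c : ℝ} {S : Set (E n)} {H : E n → Grassmannian n m}
    (hm : 0 < m) (hδ : δ ∈ Ioo (0 : ℝ) 1) (hα : 0 < α) (hM : 0 < M)
    (hαM : α * (M + 1) < δ / 50) {p q : E n} (hp : IsAdmissibleAt α M S H R c p)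
    (hq : IsAdmissibleAt α M S H R c q) (hpq : 0 < ‖q - p‖) (hR : ‖q - p‖ ≤ R / 10 ^ 5)
    (hbad : δ * ‖q - p‖ < ‖(H p).planeᗮ.starProjection (q - p)‖) :
    ∃ ξ ζ : E n, dist ξ p ≤ 3 * ‖q - p‖ ∧ dist ζ q ≤ ‖q - p‖ ∧
      (∀ x ∈ Metric.ball ξ (δ ^ 2 / 1000 * ‖q - p‖),
        ∀ y ∈ Metric.ball ζ (δ ^ 2 / 1000 * ‖q - p‖), x ≠ y ∧ dist x y ≤ 3 * ‖q - p‖) ∧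
      (∀ x ∈ nearlyParallel α M S H p ∩ Metric.ball ξ (δ ^ 2 / 1000 * ‖q - p‖),
        ∀ y ∈ nearlyParallel α M S H q ∩ Metric.ball ζ (δ ^ 2 / 1000 * ‖q - p‖),
          δ / 10 ≤ angle ((H x).plane.map (reflect x y).toLinearMap) (H y).plane) ∧
      ENNReal.ofReal (c * (δ ^ 2 / 1000 * ‖q - p‖) ^ m) ≤ Measure.hausdorffMeasure (m : ℝ)
        (nearlyParallel α M S H p ∩ Metric.ball ξ (δ ^ 2 / 1000 * ‖q - p‖)) ∧
      ENNReal.ofReal (c * (δ ^ 2 / 1000 * ‖q - p‖) ^ m) ≤ Measure.hausdorffMeasure (m : ℝ)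
        (nearlyParallel α M S H q ∩ Metric.ball ζ (δ ^ 2 / 1000 * ‖q - p‖)) := by
  obtain ⟨hδ0, hδ1⟩ := hδ
  set r := ‖q - p‖ with hr
  set s := δ ^ 2 / 1000 * r with hs
  set F := (H p).plane with hF
  have hMα : 0 < M * α := by positivity
  have hα50 : α < δ / 50 := by nlinarith
  have hMα50 : M * α < δ / 50 := by nlinarith
  have hs0 : 0 < s := by positivity
  have hδδ : δ ^ 2 ≤ δ := by nlinarith
  have hsδ : s ≤ δ / 1000 * r := by rw [hs]; gcongr
  have hδr : δ * r ≤ r := by nlinarith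
  have hαr : α * r ≤ δ / 50 * r := by gcongr
  have hsr : s ≤ r / 1000 := by linarith
  have hsR : s ∈ Ioc 0 (R / 10 ^ 5) := ⟨hs0, by linarith⟩
  set a := F.starProjection (q - p) with ha
  set b := Fᗮ.starProjection (q - p) with hb
  have har : ‖a‖ ≤ r := norm_starProjection_le _ _
  have hbr : ‖b‖ ≤ r := norm_starProjection_le _ _
  have haF : a ∈ F := F.starProjection_apply_mem _
  -- A vector of length `r` in `F`, used below as the `F`-component of `q - x`
  obtain ⟨a₀, ha₀F, ha₀⟩ : ∃ a₀ ∈ F, ‖a₀‖ = r := by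
    have hdim : 0 < Module.finrank ℝ F := (H p).finrank_eq.symm ▸ hm
    have : Nontrivial F := Module.finrank_pos_iff.1 hdim
    obtain ⟨f, hf⟩ := exists_ne (0 : F)
    have hf0 : ‖(f : E n)‖ ≠ 0 := by simpa using hf
    refine ⟨(r / ‖(f : E n)‖) • (f : E n), F.smul_mem _ f.2, ?_⟩
    rw [norm_smul, Real.norm_of_nonneg (by positivity)]
    field_simp
  obtain ⟨ζ, hζS, hζ1, hζ2, hζm⟩ := hq.exists_point hα (zero_mem _) (by simp; linarith) hs0
  have hζ : ‖ζ - q‖ ≤ 2 * s := by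
    rw [← starProjection_add_orthogonal (H q).plane (ζ - q)]
    refine (norm_add_le _ _).trans ?_
    rw [sub_zero] at hζ1
    rw [norm_zero, zero_add] at hζ2
    nlinarith
  -- Above every `v` there is a point near `p`, which becomes the centre of a candidate ball.
  have key : ∀ v ∈ F, ‖v‖ ≤ 2 * r → ∃ ξ ∈ S, dist ξ p ≤ 3 * r ∧
      (∀ x ∈ Metric.ball ξ s, ∀ y ∈ Metric.ball ζ s,
        ‖F.starProjection (x - y) - (v - a)‖ ≤ 5 * s ∧
        ‖Fᗮ.starProjection (x - y) + b‖ ≤ 5 * s + 2 * α * r) ∧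
      ENNReal.ofReal (c * s ^ m) ≤ Measure.hausdorffMeasure (m : ℝ)
        (nearlyParallel α M S H p ∩ Metric.ball ξ s) := by
    intro v hv hv2
    obtain ⟨η, hηS, hη1, hη2, hηm⟩ := hp.exists_point hα hv (by linarith) hs0
    have hη3 : α * (‖v‖ + s) ≤ 2 * α * r + s := by nlinarith
    refine ⟨η, hηS, ?_, ?_, hηm s hsR⟩
    · rw [dist_eq_norm, ← starProjection_add_orthogonal F (η - p)]
      refine (norm_add_le _ _).trans ?_
      have := norm_le_insert' (F.starProjection (η - p)) v
      have h4 : ‖F.starProjection (η - p) - v‖ < s := hη1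
      have h5 : ‖Fᗮ.starProjection (η - p)‖ ≤ α * (‖v‖ + s) := hη2
      linarith
    · intro x hx y hy
      rw [mem_ball_iff_norm] at hx hy
      have := norm_components_sub_le hη1.le (hη2.trans hη3) hζ hx.le hy.le
      exact ⟨this.1.trans (by linarith), this.2.trans (by linarith)⟩
  obtain ⟨ξ₁, -, hξ₁, h₁, hm₁⟩ := key a haF (by linarith)
  obtain ⟨ξ₂, -, hξ₂, h₂, hm₂⟩ := key (a - a₀) (F.sub_mem haF ha₀F)
    ((norm_sub_le _ _).trans (by linarith))
  have hnorm : ∀ z : E n, ‖Fᗮ.starProjection z + b‖ ≤ 5 * s + 2 * α * r →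
      93 / 100 * δ * r ≤ ‖Fᗮ.starProjection z‖ ∧ ‖Fᗮ.starProjection z‖ ≤ 105 / 100 * r := by
    intro z hz
    have e1 := norm_sub_le_norm_add b (Fᗮ.starProjection z)
    have e2 := norm_sub_le_norm_add (Fᗮ.starProjection z) b
    rw [add_comm b] at e1
    constructor <;> linarith
  have hne : ∀ x y : E n, 93 / 100 * δ * r ≤ ‖Fᗮ.starProjection (x - y)‖ → x ≠ y := by
    rintro x y h rfl
    rw [sub_self, map_zero, norm_zero] at h
    have : 0 < δ * r := by positivity
    linarith
  -- The first candidate lies above `a`, so the `F`-component of `x - y` almost vanishes.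
  have far₁ : ∀ x ∈ Metric.ball ξ₁ s, ∀ y ∈ Metric.ball ζ s, x ≠ y ∧ dist x y ≤ 3 * r ∧
      angle (F.map (reflect x y).toLinearMap) F ≤ 3 / 100 * δ := by
    intro x hx y hy
    obtain ⟨c1, c2⟩ := h₁ x hx y hy
    rw [sub_self, sub_zero] at c1
    obtain ⟨c3, c4⟩ := hnorm _ c2
    have c5 := norm_starProjection_le Fᗮ (x - y)
    refine ⟨hne x y c3, ?_, (angle_map_reflect_self_le x y F).trans ?_⟩
    · rw [dist_eq_norm, ← starProjection_add_orthogonal F (x - y)]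
      exact (norm_add_le _ _).trans (by linarith)
    · have c6 : 0 < ‖x - y‖ := norm_pos_iff.2 (sub_ne_zero.2 (hne x y c3))
      have : ‖F.starProjection (x - y)‖ / ‖x - y‖ ≤ 3 / 400 * δ := by
        rw [div_le_iff₀ c6]
        have : 3 / 400 * δ * (93 / 100 * δ * r) ≤ 3 / 400 * δ * ‖x - y‖ := by
          gcongr; exact c3.trans c5
        have : 0 ≤ δ ^ 2 * r := by positivity
        rw [hs] at c1
        linarith
      linarith
  -- The second candidate lies above `a - a₀`, so both components of `x - y` are substantial.
  have far₂ : ∀ x ∈ Metric.ball ξ₂ s, ∀ y ∈ Metric.ball ζ s, x ≠ y ∧ dist x y ≤ 3 * r ∧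
      4 / 10 * δ ≤ angle (F.map (reflect x y).toLinearMap) F := by
    intro x hx y hy
    obtain ⟨c1, c2⟩ := h₂ x hx y hy
    rw [sub_sub_cancel_left, sub_neg_eq_add] at c1
    obtain ⟨c3, c4⟩ := hnorm _ c2
    have e1 := norm_sub_le_norm_add a₀ (F.starProjection (x - y))
    have e2 := norm_sub_le_norm_add (F.starProjection (x - y)) a₀
    rw [add_comm a₀] at e1
    have c6 : 0 < ‖x - y‖ := norm_pos_iff.2 (sub_ne_zero.2 (hne x y c3))
    have c7 : ‖x - y‖ ≤ 206 / 100 * r := by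
      rw [← starProjection_add_orthogonal F (x - y)]
      exact (norm_add_le _ _).trans (by linarith)
    refine ⟨hne x y c3, ?_, le_trans ?_ (le_angle_map_reflect_self x y F)⟩
    · rw [dist_eq_norm]; linarith
    · rw [le_div_iff₀ (by positivity)]
      calc 4 / 10 * δ * ‖x - y‖ ^ 2 ≤ 4 / 10 * δ * (206 / 100 * r) ^ 2 := by gcongr
        _ ≤ 2 * (99 / 100 * r) * (93 / 100 * δ * r) := by
          have : 0 ≤ δ * r ^ 2 := by positivity
          linarith
        _ ≤ _ := by gcongr; linarith
  -- If the first candidate fails, its reflection almost maps `F` to `H q`. The second one then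
  -- cannot do so as well, because the two reflections act on `F` differently.
  by_cases hall : ∀ x ∈ nearlyParallel α M S H p ∩ Metric.ball ξ₁ s,
      ∀ y ∈ nearlyParallel α M S H q ∩ Metric.ball ζ s,
        δ / 10 ≤ angle ((H x).plane.map (reflect x y).toLinearMap) (H y).plane
  · exact ⟨ξ₁, ζ, hξ₁, by rw [dist_eq_norm]; linarith,
      fun x hx y hy => ⟨(far₁ x hx y hy).1, (far₁ x hx y hy).2.1⟩, hall, hm₁, hζm s hsR⟩
  · push Not at hall
    obtain ⟨x₁, hx₁, y₁, hy₁, hlt₁⟩ := hall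
    refine ⟨ξ₂, ζ, hξ₂, by rw [dist_eq_norm]; linarith,
      fun x hx y hy => ⟨(far₂ x hx y hy).1, (far₂ x hx y hy).2.1⟩, ?_, hm₂, hζm s hsR⟩
    intro x₂ hx₂ y₂ hy₂
    by_contra! hlt₂
    have := angle_map_reflect_self_le_add (F := F) (G := (H q).plane) hx₁.1.2.le hx₂.1.2.le
      hy₁.1.2.le hy₂.1.2.le hlt₁.le hlt₂.le
    have := (far₁ x₁ hx₁.2 y₁ hy₁.2).2.2
    have := (far₂ x₂ hx₂.2 y₂ hy₂.2).2.2
    linarith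

/-! ### Finite energy forces flatness at points of the dense subset -/

theorem mul_measure_le_upperLIntegral {X : Type*} [MeasurableSpace X] {μ : Measure X}
    {f : X → ℝ≥0∞} {A : Set X} {l : ℝ≥0∞} (h : ∀ x ∈ A, l ≤ f x) :
    l * μ A ≤ upperLIntegral μ f := by
  refine le_iInf fun g => le_iInf fun hg => le_iInf fun hfg => ?_
  have hA : A ⊆ {x | l ≤ g x} := fun x hx => (h x hx).trans (hfg x)
  exact le_trans (by gcongr) (mul_meas_ge_le_lintegral hg l)

/-- A lower bound for an iterated upper integral over a product of sets, none of which needs to be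
measurable, in terms of a measurable majorant `g` of the inner integral. -/
theorem mul_measure_le_withDensity {X : Type*} [MeasurableSpace X] {μ : Measure X}
    {f : X → X → ℝ≥0∞} {g : X → ℝ≥0∞} (hg : Measurable g)
    (hfg : ∀ y, upperLIntegral μ (fun x => f x y) ≤ g y) {A B U : Set X} (hU : MeasurableSet U)
    (hBU : B ⊆ U) {l : ℝ≥0∞} (hf : ∀ x ∈ A, ∀ y ∈ B, l ≤ f x y) :
    l * μ A * μ B ≤ μ.withDensity g U := by
  have hB : B ⊆ {y | l * μ A ≤ g y} ∩ U := fun y hy =>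
    ⟨(mul_measure_le_upperLIntegral fun x hx => hf x hx y hy).trans (hfg y), hBU hy⟩
  rw [withDensity_apply _ hU]
  refine le_trans (mul_le_mul_right ?_ _) (mul_meas_ge_le_lintegral hg (l * μ A))
  rw [Measure.restrict_apply' hU]
  exact measure_mono hB

/-- Two disjoint sets inside the same small ball cannot both have large measure, since one of them
omits the point of the compact set to which they are close. -/
theorem exists_radius_measure_lt_of_disjoint {X : Type*} [MetricSpace X] [MeasurableSpace X]
    [BorelSpace X] (ν : Measure X) [IsFiniteMeasure ν] {K : Set X} (hK : IsCompact K)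
    {c₀ : ℝ≥0∞} (hc₀ : c₀ ≠ 0) :
    ∃ t > 0, ∀ p ∈ K, ∀ U V : Set X, Disjoint U V → U ⊆ Metric.ball p t → V ⊆ Metric.ball p t →
      ν U < c₀ ∨ ν V < c₀ := by
  have hloc : ∀ z : X, ∃ t > 0, ν (Metric.ball z t \ {z}) < c₀ := by
    intro z
    have hanti : Antitone fun j : ℕ => Metric.ball z (1 / ((j : ℝ) + 1)) \ {z} := fun i j hij =>
      sdiff_subset_sdiff_left (Metric.ball_subset_ball (Nat.one_div_le_one_div hij))
    have hempty : ⋂ j : ℕ, Metric.ball z (1 / ((j : ℝ) + 1)) \ {z} = ∅ := by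
      refine eq_empty_of_forall_notMem fun x hx => ?_
      have hx := mem_iInter.1 hx
      obtain ⟨j, hj⟩ := exists_nat_one_div_lt (dist_pos.2 (hx 0).2)
      exact lt_asymm hj (hx j).1
    have hlim := tendsto_measure_iInter_atTop (μ := ν)
      (fun j : ℕ => (Metric.isOpen_ball.measurableSet.diff (measurableSet_singleton z)
        : MeasurableSet (Metric.ball z (1 / ((j : ℝ) + 1)) \ {z})).nullMeasurableSet)
      hanti ⟨0, measure_ne_top _ _⟩
    rw [hempty, measure_empty] at hlim
    obtain ⟨j, hj⟩ := (hlim.eventually_lt_const (pos_iff_ne_zero.2 hc₀)).exists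
    exact ⟨_, Nat.one_div_pos_of_nat, hj⟩
  choose t ht hνt using hloc
  obtain ⟨d, hd, hball⟩ := lebesgue_number_lemma_of_metric hK
    (c := fun z => Metric.ball z (t z)) (fun _ => Metric.isOpen_ball)
    (fun x _ => mem_iUnion.2 ⟨x, Metric.mem_ball_self (ht x)⟩)
  refine ⟨d, hd, fun p hp U V hUV hU hV => ?_⟩
  obtain ⟨z, hz⟩ := hball p hp
  by_cases hzU : z ∈ U
  · right
    refine lt_of_le_of_lt (measure_mono
      (fun x hx => ⟨hz (hV hx), ?_⟩ : V ⊆ Metric.ball z (t z) \ {z})) (hνt z)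
    rintro rfl
    exact Set.disjoint_left.1 hUV hzU hx
  · left
    refine lt_of_le_of_lt (measure_mono
      (fun x hx => ⟨hz (hU hx), ?_⟩ : U ⊆ Metric.ball z (t z) \ {z})) (hνt z)
    rintro rfl
    exact hzU hx

set_option maxHeartbeats 1000000 in
/-- Near a compact set, points of the dense subset deviate from each other's mock tangent planes by
at most `δ` times their distance. Otherwise there would be, at arbitrarily small scales, two
disjoint balls with an amount of energy bounded from below, by the scaling invariance of the
energy. -/
theorem exists_radius_norm_orthogonal_le {α M δ τ R c : ℝ} {S Sstar K : Set (E n)}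
    {H : E n → Grassmannian n m} (hm : 0 < m) (hδ : δ ∈ Ioo (0 : ℝ) 1) (hα : 0 < α) (hM : 0 < M)
    (hαM : α * (M + 1) < δ / 50) (hτ : -1 < τ) (hSc : IsClosed S)
    (hE : HasLocallyFiniteEnergy τ S H) (hK : IsCompact K) (hR : 0 < R) (hc : 0 < c)
    (hadm : ∀ p ∈ Sstar ∩ K, IsAdmissibleAt α M S H R c p) :
    ∃ r₁ > 0, ∀ p ∈ Sstar ∩ K, ∀ q ∈ Sstar ∩ K, ‖q - p‖ ≤ r₁ →
      ‖(H p).planeᗮ.starProjection (q - p)‖ ≤ δ * ‖q - p‖ := by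
  obtain ⟨C, hC⟩ := hK.isBounded.exists_norm_le
  obtain ⟨N, hN⟩ := exists_nat_gt (C + 8)
  set T := S ∩ Metric.ball 0 (N : ℝ) with hT
  have hTm : MeasurableSet T := hSc.measurableSet.inter Metric.isOpen_ball.measurableSet
  set μ := (Measure.hausdorffMeasure (m : ℝ) : Measure (E n)).restrict T with hμ
  set f : E n → E n → ℝ≥0∞ := fun x y => ENNReal.ofReal
    (angle ((H x).plane.map (reflect x y).toLinearMap) (H y).plane ^ ((1 + τ) * (m : ℝ)) /
      ‖x - y‖ ^ (2 * m)) with hf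
  have hfsymm : ∀ x y, f x y = f y x := fun x y => by
    simp only [hf, angle_map_reflect_comm x y, norm_sub_rev x y]
  obtain ⟨g, hg, hfg, hgfin⟩ : ∃ g : E n → ℝ≥0∞, Measurable g ∧
      (∀ y, upperLIntegral μ (fun x => f x y) ≤ g y) ∧ ∫⁻ y, g y ∂μ < ∞ := by
    have h := hE N
    simp only [energy] at h
    rw [upperLIntegral, iInf_lt_iff] at h
    obtain ⟨g, h⟩ := h
    rw [iInf_lt_iff] at h
    obtain ⟨hg, h⟩ := h
    rw [iInf_lt_iff] at h
    obtain ⟨hfg, h⟩ := h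
    exact ⟨g, hg, hfg, h⟩
  have : IsFiniteMeasure (μ.withDensity g) := isFiniteMeasure_withDensity hgfin.ne
  have hδ0 : 0 < δ := hδ.1
  set ε := δ ^ 2 / 1000 with hε
  have hε0 : 0 < ε := by positivity
  set k := (1 + τ) * (m : ℝ) with hk
  have hk0 : 0 < k := mul_pos (by linarith) (by exact_mod_cast hm)
  set c₀ := (δ / 10) ^ k / 3 ^ (2 * m) * (c * ε ^ m) * (c * ε ^ m) with hc₀
  have hc₀pos : 0 < c₀ := by positivity
  obtain ⟨t, ht, htK⟩ := exists_radius_measure_lt_of_disjoint (μ.withDensity g) hK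
    (c₀ := ENNReal.ofReal c₀) (by simpa using hc₀pos)
  refine ⟨min (min (t / 8) (R / 10 ^ 5)) 1, by positivity, fun p hp q hq hpq => ?_⟩
  obtain ⟨⟨hr1, hr2⟩, hr3⟩ : (‖q - p‖ ≤ t / 8 ∧ ‖q - p‖ ≤ R / 10 ^ 5) ∧ ‖q - p‖ ≤ 1 := by
    simpa only [le_min_iff] using hpq
  by_contra! hbad
  rcases (norm_nonneg (q - p)).eq_or_lt with h0 | h0
  · rw [norm_eq_zero.1 h0.symm] at hbad
    simp at hbad
  obtain ⟨ξ, ζ, hξ, hζ, hdist, hangle, hmξ, hmζ⟩ := exists_balls_le_angle hm hδ hα hM hαM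
    (hadm p hp) (hadm q hq) h0 hr2 hbad
  set r := ‖q - p‖ with hr
  rw [← hε] at hdist hangle hmξ hmζ
  set s := ε * r with hs
  have hs1 : s ≤ r := by
    have : ε ≤ 1 := by rw [hε]; nlinarith [hδ.2]
    rw [hs]; nlinarith
  have hqp : dist q p = r := dist_eq_norm q p
  have hsubξ : Metric.ball ξ s ⊆ Metric.ball p (5 * r) :=
    Metric.ball_subset_ball' (by linarith only [hs1, hξ, h0])
  have hsubζ : Metric.ball ζ s ⊆ Metric.ball p (5 * r) :=
    Metric.ball_subset_ball' (by linarith only [dist_triangle ζ q p, hs1, hζ, hqp, h0])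
  have hpN : Metric.ball p (5 * r) ⊆ Metric.ball 0 (N : ℝ) :=
    Metric.ball_subset_ball' (by rw [dist_zero_right]; linarith only [hC p hp.2, hN, hr3])
  have hpt : Metric.ball p (5 * r) ⊆ Metric.ball p t :=
    Metric.ball_subset_ball (by linarith only [hr1, ht])
  set A := nearlyParallel α M S H p ∩ Metric.ball ξ s with hA
  set B := nearlyParallel α M S H q ∩ Metric.ball ζ s with hB
  have hμA : ENNReal.ofReal (c * s ^ m) ≤ μ A := by
    have hAT : A ⊆ T := fun x hx => ⟨hx.1.1, hpN (hsubξ hx.2)⟩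
    rwa [hμ, Measure.restrict_apply' hTm, inter_eq_left.2 hAT]
  have hμB : ENNReal.ofReal (c * s ^ m) ≤ μ B := by
    have hBT : B ⊆ T := fun x hx => ⟨hx.1.1, hpN (hsubζ hx.2)⟩
    rwa [hμ, Measure.restrict_apply' hTm, inter_eq_left.2 hBT]
  set l := (δ / 10) ^ k / (3 * r) ^ (2 * m) with hl
  have hfl : ∀ x ∈ A, ∀ y ∈ B, ENNReal.ofReal l ≤ f x y := by
    intro x hx y hy
    obtain ⟨hne, hd⟩ := hdist x hx.2 y hy.2
    have hpos : 0 < ‖x - y‖ := norm_pos_iff.2 (sub_ne_zero.2 hne)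
    rw [dist_eq_norm] at hd
    refine ENNReal.ofReal_le_ofReal ?_
    exact div_le_div₀ (Real.rpow_nonneg (angle_nonneg _ _) _)
      (Real.rpow_le_rpow (by positivity) (hangle x hx y hy) hk0.le) (by positivity)
      (pow_le_pow_left₀ hpos.le hd _)
  -- The powers of `r` cancel: the energy is scaling invariant.
  have hprod : ENNReal.ofReal c₀ =
      ENNReal.ofReal l * ENNReal.ofReal (c * s ^ m) * ENNReal.ofReal (c * s ^ m) := by
    rw [← ENNReal.ofReal_mul (by positivity), ← ENNReal.ofReal_mul (by positivity)]
    congr 1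
    rw [hl, hs, hc₀, mul_pow, mul_pow]
    field_simp
    ring
  have hνζ : ENNReal.ofReal c₀ ≤ μ.withDensity g (Metric.ball ζ s) := by
    refine le_trans ?_ (mul_measure_le_withDensity hg hfg Metric.isOpen_ball.measurableSet
      inter_subset_right hfl)
    rw [hprod]
    gcongr
  have hνξ : ENNReal.ofReal c₀ ≤ μ.withDensity g (Metric.ball ξ s) := by
    refine le_trans ?_ (mul_measure_le_withDensity hg hfg Metric.isOpen_ball.measurableSet
      (inter_subset_right : A ⊆ _) (fun y hy x hx => hfsymm x y ▸ hfl x hx y hy))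
    rw [hprod]
    gcongr
  have hdisj : Disjoint (Metric.ball ξ s) (Metric.ball ζ s) :=
    Set.disjoint_left.2 fun x hx hx' => (hdist x hx x hx').1 rfl
  rcases htK p hp.2 _ _ hdisj (hsubξ.trans hpt) (hsubζ.trans hpt) with h | h
  · exact h.not_ge hνξ
  · exact h.not_ge hνζ

/-! ### Compactness of the Grassmannian and approximating planes -/

theorem trace_starProjection (F : Submodule ℝ (E n)) :
    LinearMap.trace ℝ (E n) (F.starProjection : E n →ₗ[ℝ] E n) = Module.finrank ℝ F :=
  LinearMap.IsProj.trace
    ⟨F.starProjection_apply_mem, fun _ hx => Submodule.starProjection_eq_self_iff.2 hx⟩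

/-- The projections onto `m`-dimensional subspaces are cut out by closed conditions; the dimension
is read off from the trace. -/
theorem range_starProjection_eq (n m : ℕ) :
    range (fun F : Grassmannian n m => F.plane.starProjection) =
      {P : E n →L[ℝ] E n | P * P = P ∧ star P = P ∧
        LinearMap.trace ℝ (E n) (P : E n →ₗ[ℝ] E n) = m} := by
  ext P
  constructor
  · rintro ⟨F, rfl⟩
    have h : IsStarProjection F.plane.starProjection :=
      isStarProjection_iff_eq_starProjection.2 ⟨F.plane, inferInstance, rfl⟩
    refine ⟨h.isIdempotentElem, h.isSelfAdjoint, ?_⟩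
    rw [trace_starProjection, F.finrank_eq]
  · rintro ⟨h1, h2, h3⟩
    obtain ⟨F, _, rfl⟩ := isStarProjection_iff_eq_starProjection.1 (⟨h1, h2⟩ : IsStarProjection P)
    rw [trace_starProjection] at h3
    exact ⟨⟨F, by exact_mod_cast h3⟩, rfl⟩

theorem isInducing_starProjection (n m : ℕ) :
    IsInducing (fun F : Grassmannian n m => F.plane.starProjection) := ⟨rfl⟩

instance (n m : ℕ) : CompactSpace (Grassmannian n m) := by
  rw [← isCompact_univ_iff, (isInducing_starProjection n m).isCompact_iff, image_univ]
  refine Metric.isCompact_of_isClosed_isBounded ?_ ?_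
  · rw [range_starProjection_eq]
    have htr : Continuous fun P : E n →L[ℝ] E n =>
        LinearMap.trace ℝ (E n) (P : E n →ₗ[ℝ] E n) :=
      LinearMap.continuous_of_finiteDimensional
        (LinearMap.trace ℝ (E n) ∘ₗ ContinuousLinearMap.coeLM ℝ)
    exact (isClosed_eq (continuous_id.mul continuous_id) continuous_id).inter
      ((isClosed_eq continuous_star continuous_id).inter (isClosed_eq htr continuous_const))
  · refine (Metric.isBounded_closedBall (x := (0 : E n →L[ℝ] E n)) (r := 1)).subset ?_
    rintro _ ⟨F, rfl⟩
    simpa using Submodule.starProjection_norm_le F.plane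

theorem exists_isApproximatingPlane {S Sstar : Set (E n)} (H : E n → Grassmannian n m)
    (hd : S ⊆ closure Sstar) {p : E n} (hp : p ∈ S) :
    ∃ G : Grassmannian n m, IsApproximatingPlane H Sstar p G := by
  by_cases hps : p ∈ Sstar
  · exact ⟨H p, Or.inl ⟨hps, rfl⟩⟩
  · obtain ⟨q, hq, hqp⟩ := mem_closure_iff_seq_limit.1 (hd hp)
    obtain ⟨G, hG⟩ := exists_clusterPt_of_compactSpace (map (fun k => H (q k)) atTop)
    exact ⟨G, Or.inr ⟨hps, q, hq, hqp, hG⟩⟩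

/-- Both kinds of approximating planes are limits of mock tangent planes along a sequence in the
dense subset, which is constant if `p` belongs to that subset. -/
theorem IsApproximatingPlane.exists_seq {Sstar : Set (E n)} {H : E n → Grassmannian n m} {p : E n}
    {G : Grassmannian n m} (h : IsApproximatingPlane H Sstar p G) :
    ∃ q : ℕ → E n, (∀ k, q k ∈ Sstar) ∧ Tendsto q atTop (𝓝 p) ∧
      Tendsto (fun k => (H (q k)).plane.starProjection) atTop (𝓝 G.plane.starProjection) := by
  rcases h with ⟨hp, rfl⟩ | ⟨-, q, hq, hqp, hG⟩
  · exact ⟨fun _ => p, fun _ => hp, tendsto_const_nhds, tendsto_const_nhds⟩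
  · obtain ⟨ψ, hψ, hlim⟩ := MapClusterPt.tendsto_subseq hG
    exact ⟨q ∘ ψ, fun k => hq _, hqp.comp hψ.tendsto_atTop,
      ((isInducing_starProjection n m).continuous.tendsto G).comp hlim⟩

theorem tendsto_apply_of_tendsto {P : ℕ → E n →L[ℝ] E n} {Q : E n →L[ℝ] E n} {v : ℕ → E n}
    {w : E n} (hP : Tendsto P atTop (𝓝 Q)) (hv : Tendsto v atTop (𝓝 w)) :
    Tendsto (fun k => P k (v k)) atTop (𝓝 (Q w)) :=
  (isBoundedBilinearMap_apply.continuous.tendsto (Q, w)).comp (hP.prodMk_nhds hv)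

theorem add_starProjection_mem_affinePlane (p : E n) (F : Submodule ℝ (E n)) (v : E n) :
    p + F.starProjection v ∈ affinePlane p F := by
  change p + F.starProjection v - p ∈ F
  rw [add_sub_cancel_left]
  exact F.starProjection_apply_mem v

/-! ### Distance from the set to the plane -/

/-- The flatness estimate at points of the dense subset passes to the limit, provided that `K`
contains a relative neighbourhood of the points in question. -/
theorem IsApproximatingPlane.norm_orthogonal_le {S Sstar K : Set (E n)} {H : E n → Grassmannian n m}
    {p y : E n} {G : Grassmannian n m} (h : IsApproximatingPlane H Sstar p G)
    (hsub : Sstar ⊆ S) (hd : S ⊆ closure Sstar) {δ r₁ : ℝ}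
    (hflat : ∀ p ∈ Sstar ∩ K, ∀ q ∈ Sstar ∩ K, ‖q - p‖ ≤ r₁ →
      ‖(H p).planeᗮ.starProjection (q - p)‖ ≤ δ * ‖q - p‖)
    {U : Set (E n)} (hU : IsOpen U) (hUK : S ∩ U ⊆ K) (hpU : p ∈ U) (hy : y ∈ S) (hyU : y ∈ U)
    (hyp : ‖y - p‖ < r₁) :
    ‖G.planeᗮ.starProjection (y - p)‖ ≤ δ * ‖y - p‖ := by
  obtain ⟨q, hq, hqp, hqG⟩ := h.exists_seq
  obtain ⟨z, hz, hzy⟩ := mem_closure_iff_seq_limit.1 (hd hy)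
  have hdiff : Tendsto (fun k => z k - q k) atTop (𝓝 (y - p)) := hzy.sub hqp
  simp only [Submodule.starProjection_orthogonal_val] at hflat ⊢
  refine le_of_tendsto_of_tendsto (hdiff.sub (tendsto_apply_of_tendsto hqG hdiff)).norm
    (hdiff.norm.const_mul δ) ?_
  filter_upwards [hqp.eventually_mem (hU.mem_nhds hpU), hzy.eventually_mem (hU.mem_nhds hyU),
    hdiff.norm.eventually_lt_const hyp] with k h1 h2 h3
  exact hflat _ ⟨hq k, hUK ⟨hsub (hq k), h1⟩⟩ _ ⟨hz k, hUK ⟨hsub (hz k), h2⟩⟩ h3.le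

/-- The nearest point of the plane stays in the ball. -/
theorem infDist_affinePlane_inter_ball_le {F : Submodule ℝ (E n)} {p y : E n} {r : ℝ}
    (hy : y ∈ Metric.ball p r) :
    Metric.infDist y (affinePlane p F ∩ Metric.ball p r) ≤ ‖Fᗮ.starProjection (y - p)‖ := by
  rw [mem_ball_iff_norm] at hy
  have hmem : p + F.starProjection (y - p) ∈ affinePlane p F ∩ Metric.ball p r := by
    refine ⟨add_starProjection_mem_affinePlane p F _, ?_⟩
    rw [mem_ball_iff_norm, add_sub_cancel_left]
    exact (norm_starProjection_le F _).trans_lt hy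
  refine (Metric.infDist_le_dist_of_mem hmem).trans_eq ?_
  rw [dist_eq_norm, Submodule.starProjection_orthogonal_val]
  congr 1
  abel

/-! ### Distance from the plane to the set -/

/-- The bound is obtained by shrinking the given point towards `p` by the factor `√(1 + α²)`, so
that the point of the cone above it still lies in the ball. -/
theorem IsAdmissibleAt.infDist_le {α M R c : ℝ} {S : Set (E n)} {H : E n → Grassmannian n m}
    {p : E n} (h : IsAdmissibleAt α M S H R c p) (hα : 0 < α) {v : E n} (hv : v ∈ (H p).plane)
    {r : ℝ} (hr : r ≤ R) (hvr : ‖v‖ < r) :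
    Metric.infDist (p + v) (S ∩ Metric.ball p r) ≤
      (√(1 + α ^ 2) - 1 + α) / √(1 + α ^ 2) * r := by
  set L := √(1 + α ^ 2) with hL
  have hL1 : 1 ≤ L := Real.one_le_sqrt.2 (by nlinarith [sq_nonneg α])
  have hLsq : L ^ 2 = 1 + α ^ 2 := Real.sq_sqrt (by positivity)
  have hL0 : 0 < L := by linarith
  have hv' : ‖L⁻¹ • v‖ = ‖v‖ / L := by
    rw [norm_smul, Real.norm_of_nonneg (by positivity)]; ring
  have hvL : ‖v‖ / L < r / L := by gcongr
  have hvL' : ‖v‖ / L ≤ ‖v‖ := div_le_self (norm_nonneg _) hL1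
  refine le_of_forall_pos_le_add fun e he => ?_
  obtain ⟨s, hs0, hse, hs⟩ : ∃ s, 0 < s ∧ s ≤ e ∧ s < r / L - ‖v‖ / L :=
    ⟨min e ((r / L - ‖v‖ / L) / 2), lt_min he (by linarith), min_le_left _ _,
      (min_le_right _ _).trans_lt (by linarith)⟩
  obtain ⟨η, hηS, h1, h2, -⟩ := h.exists_point hα ((H p).plane.smul_mem L⁻¹ hv)
    (by rw [hv']; linarith) hs0
  set P := (H p).plane.starProjection
  set Q := (H p).planeᗮ.starProjection
  rw [hv'] at h2
  have h3 : ‖P (η - p)‖ ≤ ‖v‖ / L + s := by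
    have := norm_le_insert' (P (η - p)) (L⁻¹ • v)
    rw [hv'] at this
    linarith
  have hη : η ∈ Metric.ball p r := by
    rw [mem_ball_iff_norm]
    refine lt_of_pow_lt_pow_left₀ 2 ((norm_nonneg v).trans hvr.le) ?_
    rw [Submodule.norm_sq_eq_add_norm_sq_starProjection (η - p) (H p).plane]
    calc ‖P (η - p)‖ ^ 2 + ‖Q (η - p)‖ ^ 2
        ≤ (‖v‖ / L + s) ^ 2 + (α * (‖v‖ / L + s)) ^ 2 := by gcongr
      _ = (‖v‖ / L + s) ^ 2 * L ^ 2 := by rw [hLsq]; ring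
      _ < (r / L) ^ 2 * L ^ 2 := by gcongr; linarith
      _ = r ^ 2 := by field_simp
  refine (Metric.infDist_le_dist_of_mem (show η ∈ S ∩ Metric.ball p r from ⟨hηS, hη⟩)).trans ?_
  have e1 : p + v - η = (v - L⁻¹ • v) - (P (η - p) - L⁻¹ • v) - Q (η - p) := by
    have := starProjection_add_orthogonal (H p).plane (η - p)
    rw [eq_sub_of_add_eq this]
    abel
  have e2 : ‖v - L⁻¹ • v‖ = (1 - L⁻¹) * ‖v‖ := by
    rw [show v - L⁻¹ • v = (1 - L⁻¹) • v by module, norm_smul,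
      Real.norm_of_nonneg (sub_nonneg.2 (inv_le_one_of_one_le₀ hL1))]
  have e3 : (1 - L⁻¹) * ‖v‖ ≤ (1 - L⁻¹) * r := by
    have := sub_nonneg.2 (inv_le_one_of_one_le₀ hL1)
    gcongr
  have e4 : α * (‖v‖ / L + s) ≤ α * (r / L) := by gcongr; linarith
  have e5 : (L - 1 + α) / L * r = (1 - L⁻¹) * r + α * (r / L) := by field_simp
  rw [dist_eq_norm, e1, e5]
  refine (norm_sub_le _ _).trans ?_
  have := norm_sub_le (v - L⁻¹ • v) (P (η - p) - L⁻¹ • v)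
  linarith

/-- The bound passes to limits; it is applied at the approximating points with slightly smaller
radii `r' < r`, so that the balls are contained in the ball of radius `r` around `p`. -/
theorem IsApproximatingPlane.infDist_le {α M R c : ℝ} {S Sstar K : Set (E n)}
    {H : E n → Grassmannian n m} {p : E n} {G : Grassmannian n m}
    (h : IsApproximatingPlane H Sstar p G) (hsub : Sstar ⊆ S)
    (hadm : ∀ p ∈ Sstar ∩ K, IsAdmissibleAt α M S H R c p) (hα : 0 < α)
    {U : Set (E n)} (hU : IsOpen U) (hUK : S ∩ U ⊆ K) (hpU : p ∈ U)
    {v : E n} (hv : v ∈ G.plane) {r : ℝ} (hr : r ≤ R) (hvr : ‖v‖ < r) :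
    Metric.infDist (p + v) (S ∩ Metric.ball p r) ≤
      (√(1 + α ^ 2) - 1 + α) / √(1 + α ^ 2) * r := by
  obtain ⟨q, hq, hqp, hqG⟩ := h.exists_seq
  obtain ⟨r', hvr', hr'⟩ := exists_between hvr
  have hlim : Tendsto (fun k => q k + (H (q k)).plane.starProjection v) atTop (𝓝 (p + v)) := by
    have := hqp.add (tendsto_apply_of_tendsto hqG (tendsto_const_nhds (x := v)))
    rwa [Submodule.starProjection_eq_self_iff.2 hv] at this
  refine le_of_tendsto (((Metric.continuous_infDist_pt _).tendsto _).comp hlim) ?_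
  filter_upwards [hqp.eventually_mem (hU.mem_nhds hpU),
    hqp.eventually_mem (Metric.ball_mem_nhds p (sub_pos.2 hr'))] with k h1 h2
  have hball : Metric.ball (q k) r' ⊆ Metric.ball p r :=
    Metric.ball_subset_ball' (by rw [Metric.mem_ball] at h2; linarith)
  have hkS : q k ∈ S := hsub (hq k)
  have hL1 : 1 ≤ √(1 + α ^ 2) := Real.one_le_sqrt.2 (by nlinarith [sq_nonneg α])
  calc _ ≤ Metric.infDist (q k + (H (q k)).plane.starProjection v) (S ∩ Metric.ball (q k) r') :=
        Metric.infDist_le_infDist_of_subset (inter_subset_inter_right _ hball)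
          ⟨q k, hkS, Metric.mem_ball_self ((norm_nonneg v).trans_lt hvr')⟩
    _ ≤ (√(1 + α ^ 2) - 1 + α) / √(1 + α ^ 2) * r' :=
        (hadm _ ⟨hq k, hUK ⟨hkS, h1⟩⟩).infDist_le hα (Submodule.starProjection_apply_mem _ _)
          (hr'.le.trans hr) ((norm_starProjection_le _ _).trans_lt hvr')
    _ ≤ _ := by
        have : 0 ≤ √(1 + α ^ 2) - 1 + α := by linarith
        gcongr

theorem sqrt_one_add_sq_lt {α : ℝ} (hα : 0 < α) : √(1 + α ^ 2) < 1 + α := by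
  rw [Real.sqrt_lt' (by linarith)]
  linarith [add_sq 1 α]

theorem thetaNumber_le {S : Set (E n)} {p : E n} {F : Submodule ℝ (E n)} {r δ : ℝ} (hr : 0 < r)
    (hδ : 0 ≤ δ)
    (h₁ : ∀ y ∈ S ∩ Metric.ball p r,
      Metric.infDist y (affinePlane p F ∩ Metric.ball p r) ≤ δ * r)
    (h₂ : ∀ ξ ∈ affinePlane p F ∩ Metric.ball p r,
      Metric.infDist ξ (S ∩ Metric.ball p r) ≤ δ * r) :
    thetaNumber S p F r ≤ δ := by
  rw [thetaNumber, div_le_iff₀ hr]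
  exact Metric.hausdorffDist_le_of_infDist (by positivity) h₁ h₂

end MoebiusEnergy

theorem mainTheorem4 (m n : ℕ) (hm : 2 ≤ m) (hmn : m ≤ n)
    (δ α M τ : ℝ) (hδ : δ ∈ Ioo (0 : ℝ) 1) (hα : 0 < α) (hM : 0 < M)
    (hαM : α * (M + 1) < δ / 50) (hτ : -1 < τ)
    (S : Set (E n)) (H : E n → Grassmannian n m) (Sstar : Set (E n))
    (hS : IsAdmissible α M S H Sstar) (hE : HasLocallyFiniteEnergy τ S H) :
    (∀ K ⊆ S, IsCompact K → ∀ R : ℝ, IsAdmissibleRadius α M S H Sstar K R →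
      ∃ r_K ∈ Ioc (0 : ℝ) R, ∃ ρ_K ∈ Ioc (0 : ℝ) R, ∀ p ∈ K,
        (∃ G : Grassmannian n m, IsApproximatingPlane H Sstar p G) ∧
        ∀ G : Grassmannian n m, IsApproximatingPlane H Sstar p G →
          (∀ r ∈ Ioc (0 : ℝ) r_K,
            S ∩ Metric.ball p r ⊆ Metric.cthickening (δ * r) (affinePlane p G.plane) ∧
            betaNumber S p G.plane r ≤ δ) ∧
          (∀ r ∈ Ioc (0 : ℝ) ρ_K,
            planeToSet S p G.plane r ≤ 2 * α / √(1 + α ^ 2) ∧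
            (p ∈ Sstar → planeToSet S p G.plane r < 2 * α / √(1 + α ^ 2))) ∧
          ∀ r ∈ Ioc (0 : ℝ) (min r_K ρ_K), thetaNumber S p G.plane r ≤ δ) ∧
    IsReifenbergFlat m δ S := by
  have hδ0 : 0 < δ := hδ.1
  have hL1 : 1 ≤ √(1 + α ^ 2) := Real.one_le_sqrt.2 (by nlinarith [sq_nonneg α])
  set C := (√(1 + α ^ 2) - 1 + α) / √(1 + α ^ 2) with hC
  have hC0 : 0 ≤ C := div_nonneg (by linarith) (by linarith)
  have hClt : C < 2 * α / √(1 + α ^ 2) := by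
    have := sqrt_one_add_sq_lt hα
    rw [hC]; gcongr; linarith
  have hCδ : C ≤ δ := by
    have h1 : 2 * α / √(1 + α ^ 2) ≤ 2 * α := div_le_self (by positivity) hL1
    have h2 : 0 < α * M := by positivity
    linarith
  refine and_iff_left_of_imp ?_ |>.2 ?_
  · intro hmain K hKS hK
    obtain ⟨R, hR⟩ := hS.radius K hKS hK
    obtain ⟨r_K, hr_K, ρ_K, hρ_K, h⟩ := hmain K hKS hK R hR
    refine ⟨min r_K ρ_K, lt_min hr_K.1 hρ_K.1, fun p hp r hr => ?_⟩
    obtain ⟨⟨G, hG⟩, hall⟩ := h p hp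
    exact ⟨G, (hall G hG).2.2 r hr⟩
  intro K hKS hK R hR
  -- The points of `Sstar` approximating a point of `K` need not lie in `K`; they do lie in a
  -- compact neighbourhood of `K` in `S`.
  set K' := S ∩ Metric.cthickening 1 K with hK'
  have hK'c : IsCompact K' := hK.cthickening.inter_left hS.isClosed
  obtain ⟨R', ⟨hR'0, -⟩, c, hc, hadm⟩ := hS.radius K' inter_subset_left hK'c
  obtain ⟨r₁, hr₁, hflat⟩ := exists_radius_norm_orthogonal_le (R := R') (c := c) (by lia) hδ hα hM
    hαM hτ hS.isClosed hE hK'c hR'0 hc hadm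
  have hR0 := hR.1.1
  refine ⟨min R (min r₁ 1), ⟨by positivity, min_le_left _ _⟩, min R R',
    ⟨by positivity, min_le_left _ _⟩, fun p hp =>
    ⟨exists_isApproximatingPlane H hS.dense (hKS hp), fun G hG => ?_⟩⟩
  have hUK : S ∩ Metric.ball p 1 ⊆ K' := fun y hy =>
    ⟨hy.1, Metric.mem_cthickening_of_dist_le y p 1 K hp (Metric.mem_ball.1 hy.2).le⟩
  have hp1 : p ∈ Metric.ball p 1 := Metric.mem_ball_self one_pos
  have near : ∀ r ∈ Ioc 0 (min R (min r₁ 1)), ∀ y ∈ S ∩ Metric.ball p r,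
      ‖G.planeᗮ.starProjection (y - p)‖ ≤ δ * r := by
    intro r hr y hy
    have hyp := mem_ball_iff_norm.1 hy.2
    have h1 := hr.2.trans (min_le_right _ _)
    refine (hG.norm_orthogonal_le hS.subset hS.dense hflat Metric.isOpen_ball hUK hp1 hy.1
      (mem_ball_iff_norm.2 (hyp.trans_le (h1.trans (min_le_right _ _))))
      (hyp.trans_le (h1.trans (min_le_left _ _)))).trans ?_
    gcongr
  have far : ∀ r ∈ Ioc 0 (min R R'), ∀ ξ ∈ affinePlane p G.plane ∩ Metric.ball p r,
      Metric.infDist ξ (S ∩ Metric.ball p r) ≤ C * r := by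
    intro r hr ξ hξ
    have := hG.infDist_le hS.subset hadm hα Metric.isOpen_ball hUK hp1 hξ.1
      (hr.2.trans (min_le_right _ _)) (mem_ball_iff_norm.1 hξ.2)
    rwa [add_sub_cancel] at this
  have hplane : ∀ r ∈ Ioc 0 (min R R'), planeToSet S p G.plane r ≤ C := fun r hr =>
    Real.iSup_le (fun ξ => (div_le_iff₀ hr.1).2 (far r hr ξ ξ.2)) hC0
  refine ⟨fun r hr => ⟨fun y hy => ?_, ?_⟩,
    fun r hr => ⟨(hplane r hr).trans hClt.le, fun _ => (hplane r hr).trans_lt hClt⟩,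
    fun r hr => ?_⟩
  · refine Metric.mem_cthickening_of_dist_le y (p + G.plane.starProjection (y - p)) _ _
      (add_starProjection_mem_affinePlane _ _ _) ((le_of_eq ?_).trans (near r hr y hy))
    rw [dist_eq_norm, Submodule.starProjection_orthogonal_val]
    congr 1
    abel
  · exact Real.iSup_le (fun y => (div_le_iff₀ hr.1).2
      ((infDist_affinePlane_inter_ball_le y.2.2).trans (near r hr y y.2))) hδ0.le
  · refine thetaNumber_le hr.1 hδ0.le (fun y hy => (infDist_affinePlane_inter_ball_le hy.2).trans
      (near r ⟨hr.1, hr.2.trans (min_le_left _ _)⟩ y hy)) fun ξ hξ => ?_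
    refine (far r ⟨hr.1, hr.2.trans (min_le_right _ _)⟩ ξ hξ).trans ?_
    have := hr.1
    gcongr
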